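/- Let $M$ be a closed smooth manifold with a contact form $\alpha$ and contact structure $\xi=\ker\alpha$, and let $(\phi_\alpha^t)_{t\in\mathbb R}$ be the Reeb flow of $\alpha$, i.e. the flow of the vector field $R_\alpha$ determined by $\alpha(R_\alpha)\equiv 1$ and $d\alpha(R_\alpha,\cdot)\equiv 0$. A contact isotopy is a family $(\phi_t)_{t\in[0,1]}$ of contactomorphisms of $(M,\xi)$ such that $(t,x)\mapsto\phi_t(x)$ is smooth on $[0,1]\times M$. Let $\mathrm{Cont}_0(M,\xi)$ be the group of contactomorphisms that are contact isotopic to the identity, with the $C^1$-topology, let $\widetilde{\mathrm{Cont}_0}(M,\xi)$ be its universal cover (classes of paths starting at the identity, up to homotopy relative to endpoints, with pointwise composition as product), and let $\Pi:\widetilde{\mathrm{Cont}_0}(M,\xi)\to\mathrm{Cont}_0(M,\xi)$ be the projection. A point $x$ is a discriminant point of $\phi$ if $\phi(x)=x$ and $(\phi^*\alpha)_x=\alpha_x$. The $\alpha$-spectrum of $\phi\in\mathrm{Cont}_0(M,\xi)$ is $$\mathrm{Spec}^\alpha(\phi)=\{t\in\mathbb R : \phi_\alpha^{-t}\circ\phi\text{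 has a discriminant point}\}.$$ An $\alpha$-spectral selector is a continuous map $c:\widetilde{\mathrm{Cont}_0}(M,\xi)\to\mathbb R$ such that $c(\tilde\phi)\in\mathrm{Spec}^\alpha(\Pi(\tilde\phi))$ for all $\tilde\phi$. For $U\subset M$ write $\mathcal O_\alpha(U)=\bigcup_{t\in\mathbb R}\phi_\alpha^t(U)$; a diffeomorphism $\psi$ $\alpha$-displaces $U$ if $\psi(\mathcal O_\alpha(U))\cap\mathcal O_\alpha(U)=\emptyset$. **Proposition.** Let $c$ be an $\alpha$-spectral selector and let $U\subset M$ be a non-empty open set. Let $\tilde\phi\in\widetilde{\mathrm{Cont}_0}(M,\xi)$ be represented by a contact isotopy $(\phi_t)$ starting at the identity and supported in $U$, i.e. $\overline{\bigcup_{t\in[0,1]}\mathrm{Supp}(\phi_t)}\subset U$ with $\mathrm{Supp}(\phi_t)=\overline{\{x : \phi_t(x)\neq x\}}$, and let $\tilde\psi\in\widetilde{\mathrm{Cont}_0}(M,\xi)$ be such that $\Pi(\tilde\psi)$ $\alpha$-displaces $U$. Then $$c(\tilde\psi\cdot\tilde\phi)=c(\tilde\psi).$$ -/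

import Mathlib

open scoped Manifold ContDiff

noncomputable section

namespace ContactSpectral

/-! ### Contact forms and their Reeb flows -/

section Forms

variable {E : Type*} [NormedAddCommGroup E] [NormedSpace ℝ E]
  {M : Type*} [TopologicalSpace M] [ChartedSpace E M] [IsManifold 𝓘(ℝ, E) ∞ M]

/-- The expression in the chart around `x` of a field of covectors `β` on `M`, that is, the
pull-back of `β` by the inverse of the chart. -/
def chartForm (β : ∀ x : M, TangentSpace 𝓘(ℝ, E) x →L[ℝ] ℝ) (x : M) (y : E) : E →L[ℝ] ℝ :=
  (β ((extChartAt 𝓘(ℝ, E) x).symm y)).comp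
    (mfderiv 𝓘(ℝ, E) 𝓘(ℝ, E) (extChartAt 𝓘(ℝ, E) x).symm y)

/-- The exterior derivative of a 1-form: `dβ(v, w) = ∂_v (b w) - ∂_w (b v)` in the chart around
the point, `b` being the expression of `β` in that chart. -/
def extDerivForm (β : ∀ x : M, TangentSpace 𝓘(ℝ, E) x →L[ℝ] ℝ) (x : M)
    (v w : TangentSpace 𝓘(ℝ, E) x) : ℝ :=
  let b := fderiv ℝ (chartForm β x) (extChartAt 𝓘(ℝ, E) x x)
  let D : TangentSpace 𝓘(ℝ, E) x →L[ℝ] E :=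
    mfderiv 𝓘(ℝ, E) 𝓘(ℝ, E) (extChartAt 𝓘(ℝ, E) x) x
  b (D v) (D w) - b (D w) (D v)

variable (E M) in
/-- A contact form on a manifold `M` modelled on `E`: a smooth 1-form `α` that vanishes nowhere
and such that `dα` is nondegenerate on the hyperplanes `ker α`. The existence of a nondegenerate
alternating form on `ker α` forces the dimension to be odd, `dim E = 2 n + 1` (unless `M` is empty),
and the two conditions together say that `α ∧ (dα) ^ n` vanishes nowhere. -/
structure ContactForm where
  /-- the underlying field of covectors -/
  toFun : ∀ x : M, TangentSpace 𝓘(ℝ, E) x →L[ℝ] ℝ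
  smooth : ContMDiff 𝓘(ℝ, E)
    (𝓘(ℝ, E).prod 𝓘(ℝ, E →L[ℝ] ℝ)) ∞
    (fun x : M ↦ Bundle.TotalSpace.mk' (E →L[ℝ] ℝ)
      (E := fun x : M ↦ TangentSpace 𝓘(ℝ, E) x →L[ℝ] Bundle.Trivial M ℝ x) x (toFun x))
  ne_zero : ∀ x, toFun x ≠ 0
  nondegenerate : ∀ (x : M) (v : TangentSpace 𝓘(ℝ, E) x), toFun x v = 0 →
    (∀ w : TangentSpace 𝓘(ℝ, E) x, toFun x w = 0 → extDerivForm toFun x v w = 0) → v = 0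

namespace ContactForm

variable (α : ContactForm E M)

/-- `R` is the Reeb vector field of `α`: `α(R) = 1` and `dα(R, ·) = 0`. -/
def IsReebField (R : ∀ x : M, TangentSpace 𝓘(ℝ, E) x) : Prop :=
  ∀ x, α.toFun x (R x) = 1 ∧
    ∀ v : TangentSpace 𝓘(ℝ, E) x, extDerivForm α.toFun x (R x) v = 0

/-- `Φ` is the Reeb flow of `α`, that is, the (global, smooth) flow of the Reeb vector field.
On a closed manifold there is exactly one such `Φ`, so that "there is a Reeb flow `Φ` with ..." in
the definitions below means "the Reeb flow satisfies ...". -/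
def IsReebFlow (Φ : ℝ → M → M) : Prop :=
  ContMDiff (𝓘(ℝ, ℝ).prod 𝓘(ℝ, E)) 𝓘(ℝ, E) ∞ (fun p : ℝ × M ↦ Φ p.1 p.2) ∧
  (∀ x, Φ 0 x = x) ∧
  ∃ R : ∀ x : M, TangentSpace 𝓘(ℝ, E) x, α.IsReebField R ∧
    ∀ x, IsMIntegralCurve (I := 𝓘(ℝ, E)) (fun t ↦ Φ t x) R

/-- The `α`-orbit of `U`: the union of the images of `U` under the Reeb flow. -/
def orbit (U : Set M) : Set M :=
  {y | ∃ Φ, α.IsReebFlow Φ ∧ ∃ t : ℝ, ∃ x ∈ U, y = Φ t x}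

/-- `φ` `α`-displaces `U`: it displaces the `α`-orbit of `U` from itself. -/
def Displaces (φ : M → M) (U : Set M) : Prop :=
  φ '' α.orbit U ∩ α.orbit U = ∅

/-- `x` is a discriminant point of `φ`: `φ x = x` and `(φ^* α)_x = α_x`. -/
def IsDiscriminantPoint (φ : M → M) (x : M) : Prop :=
  φ x = x ∧
    (α.toFun (φ x)).comp (mfderiv 𝓘(ℝ, E) 𝓘(ℝ, E) φ x) = α.toFun x

/-- The `α`-spectrum of `φ`: the times `t` such that the composition of `φ` with the time `-t`
map of the Reeb flow has a discriminant point. -/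
def spectrum (φ : M → M) : Set ℝ :=
  {t | ∃ Φ, α.IsReebFlow Φ ∧ ∃ x, α.IsDiscriminantPoint (Φ (-t) ∘ φ) x}

/-! ### The group of contactomorphisms that are contact isotopic to the identity -/

/-- `φ` is a contactomorphism of `(M, ker α)`: its differential maps `ker α` to `ker α`. -/
def IsContactomorphism (φ : M ≃ₘ^∞⟮𝓘(ℝ, E), 𝓘(ℝ, E)⟯ M) : Prop :=
  ∀ (x : M) (v : TangentSpace 𝓘(ℝ, E) x),
    α.toFun (φ x) (mfderiv 𝓘(ℝ, E) 𝓘(ℝ, E) φ x v) = 0 ↔ α.toFun x v = 0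

/-- A contact isotopy: a family of contactomorphisms indexed by `[0, 1]` that is jointly smooth
as a map `[0, 1] × M → M`. -/
def IsContactIsotopy
    (φ : unitInterval → (M ≃ₘ^∞⟮𝓘(ℝ, E), 𝓘(ℝ, E)⟯ M)) : Prop :=
  (∀ t, α.IsContactomorphism (φ t)) ∧
  ContMDiff ((𝓡∂ 1).prod 𝓘(ℝ, E)) 𝓘(ℝ, E) ∞
    (fun p : unitInterval × M ↦ φ p.1 p.2)

/-- `Cont₀(M, ker α)`: the contactomorphisms that are contact isotopic to the identity. -/
def Cont₀ : Type _ :=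
  {φ : M ≃ₘ^∞⟮𝓘(ℝ, E), 𝓘(ℝ, E)⟯ M //
    ∃ h : unitInterval → (M ≃ₘ^∞⟮𝓘(ℝ, E), 𝓘(ℝ, E)⟯ M),
      α.IsContactIsotopy h ∧ h 0 = Diffeomorph.refl 𝓘(ℝ, E) M ∞ ∧ h 1 = φ}

variable {α}

theorem isContactomorphism_refl :
    α.IsContactomorphism (Diffeomorph.refl 𝓘(ℝ, E) M ∞) := by
  intro x v
  rw [Diffeomorph.coe_refl, mfderiv_id]
  rfl

theorem IsContactomorphism.trans {φ ψ : M ≃ₘ^∞⟮𝓘(ℝ, E), 𝓘(ℝ, E)⟯ M}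
    (hφ : α.IsContactomorphism φ) (hψ : α.IsContactomorphism ψ) :
    α.IsContactomorphism (φ.trans ψ) := by
  intro x v
  have h : mfderiv 𝓘(ℝ, E) 𝓘(ℝ, E) (φ.trans ψ) x =
      (mfderiv 𝓘(ℝ, E) 𝓘(ℝ, E) ψ (φ x)).comp
        (mfderiv 𝓘(ℝ, E) 𝓘(ℝ, E) φ x) := by
    rw [Diffeomorph.coe_trans]
    exact mfderiv_comp x (ψ.mdifferentiable (by simp) _) (φ.mdifferentiable (by simp) _)
  rw [h]
  exact (hψ (φ x) _).trans (hφ x v)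

theorem IsContactIsotopy.trans
    {φ ψ : unitInterval → (M ≃ₘ^∞⟮𝓘(ℝ, E), 𝓘(ℝ, E)⟯ M)}
    (hφ : α.IsContactIsotopy φ) (hψ : α.IsContactIsotopy ψ) :
    α.IsContactIsotopy (fun t ↦ (φ t).trans (ψ t)) :=
  ⟨fun t ↦ (hφ.1 t).trans (hψ.1 t), hψ.2.comp (contMDiff_fst.prodMk hφ.2)⟩

namespace Cont₀

instance : CoeFun α.Cont₀ (fun _ ↦ M → M) := ⟨fun φ ↦ φ.1⟩

@[ext]
theorem ext {φ ψ : α.Cont₀} (h : ∀ x, φ x = ψ x) : φ = ψ :=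
  Subtype.ext (Diffeomorph.ext h)

instance : One α.Cont₀ :=
  ⟨⟨Diffeomorph.refl 𝓘(ℝ, E) M ∞, fun _ ↦ Diffeomorph.refl 𝓘(ℝ, E) M ∞,
    ⟨fun _ ↦ isContactomorphism_refl, contMDiff_snd⟩, rfl, rfl⟩⟩

/-- The product is the composition `φ ∘ ψ`. -/
instance : Mul α.Cont₀ :=
  ⟨fun φ ψ ↦ ⟨ψ.1.trans φ.1, by
    obtain ⟨h, hh, h0, h1⟩ := φ.2
    obtain ⟨k, hk, k0, k1⟩ := ψ.2
    exact ⟨fun t ↦ (k t).trans (h t), hk.trans hh, by simp [h0, k0], by simp [h1, k1]⟩⟩⟩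

@[simp] theorem coe_one : ((1 : α.Cont₀) : M → M) = id := rfl

@[simp] theorem coe_mul (φ ψ : α.Cont₀) : ((φ * ψ : α.Cont₀) : M → M) = φ ∘ ψ := rfl

instance : Monoid α.Cont₀ where
  mul_assoc _ _ _ := rfl
  one_mul _ := rfl
  mul_one _ := rfl

/-- The tangent map of an element of `Cont₀`. -/
def tangent (φ : α.Cont₀) :
    C(TangentBundle 𝓘(ℝ, E) M, TangentBundle 𝓘(ℝ, E) M) :=
  ⟨tangentMap 𝓘(ℝ, E) 𝓘(ℝ, E) φ, φ.1.contMDiff.continuous_tangentMap (by simp)⟩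

/-- The `C¹`-topology on `Cont₀`: the topology of locally uniform convergence of the tangent
maps. -/
instance : TopologicalSpace α.Cont₀ :=
  TopologicalSpace.induced tangent inferInstance

theorem tangent_mul (φ ψ : α.Cont₀) : (φ * ψ).tangent = φ.tangent.comp ψ.tangent := by
  ext1 p
  exact congrFun (tangentMap_comp (φ.1.mdifferentiable (by simp))
    (ψ.1.mdifferentiable (by simp))) p

instance [FiniteDimensional ℝ E] : ContinuousMul α.Cont₀ where
  continuous_mul := by
    have : LocallyCompactSpace (TangentBundle 𝓘(ℝ, E) M) :=
      Manifold.locallyCompact_of_finiteDimensional 𝓘(ℝ, E).tangent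
    rw [continuous_induced_rng]
    have h : (tangent ∘ fun p : α.Cont₀ × α.Cont₀ ↦ p.1 * p.2) =
        fun p ↦ p.1.tangent.comp p.2.tangent := funext fun p ↦ tangent_mul p.1 p.2
    rw [h]
    have ht : Continuous (tangent (α := α)) := continuous_induced_dom
    exact (ht.comp continuous_fst).compCM (ht.comp continuous_snd)

end Cont₀

end ContactForm

end Forms

/-! ### The universal cover of a topological monoid -/

/-- The space of paths in `X` starting at `1`, with the compact-open topology. -/
abbrev BasedPath (X : Type*) [TopologicalSpace X] [One X] : Type _ :=
  {p : C(unitInterval, X) // p 0 = 1}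

/-- Homotopy of paths relative to the endpoints. -/
def BasedPath.setoid (X : Type*) [TopologicalSpace X] [One X] : Setoid (BasedPath X) where
  r p q := ContinuousMap.HomotopicRel p.1 q.1 {0, 1}
  iseqv := ⟨fun p ↦ .refl p.1, fun h ↦ h.symm, fun h h' ↦ h.trans h'⟩

/-- The universal cover of (the identity component of) `X` based at `1`: the paths starting at `1`
up to homotopy relative to the endpoints, with the quotient of the compact-open topology. This is
the usual topology of the universal cover when `X` is locally contractible. -/
def UniversalCover (X : Type*) [TopologicalSpace X] [One X] : Type _ :=
  Quotient (BasedPath.setoid X)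

namespace UniversalCover

section

variable {X : Type*} [TopologicalSpace X] [One X]

instance : TopologicalSpace (UniversalCover X) :=
  inferInstanceAs (TopologicalSpace (Quotient (BasedPath.setoid X)))

/-- The class of a path. -/
def mk (p : BasedPath X) : UniversalCover X := Quotient.mk (BasedPath.setoid X) p

/-- The projection `Π`, sending the class of a path to the endpoint of the path. -/
def proj : UniversalCover X → X :=
  Quotient.lift (fun p : BasedPath X ↦ p.1 1) fun _ _ h ↦
    ContinuousMap.HomotopicRel.fst_eq_snd h (by simp)

end

variable {X : Type*} [TopologicalSpace X] [Monoid X] [ContinuousMul X]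

/-- The product of the universal cover, induced by the pointwise product of paths. -/
instance : Mul (UniversalCover X) :=
  ⟨Quotient.map₂ (fun p q : BasedPath X ↦ ⟨p.1 * q.1, by simp [p.2, q.2]⟩) (by
    rintro p p' ⟨H⟩ q q' ⟨K⟩
    refine ⟨⟨⟨⟨fun x ↦ H x * K x, by fun_prop⟩, by simp, by simp⟩, ?_⟩⟩
    intro t x hx
    have h := H.prop t x hx
    have k := K.prop t x hx
    simp_all)⟩

theorem mk_mul_mk (p q : BasedPath X) :
    mk p * mk q = mk ⟨p.1 * q.1, by simp [p.2, q.2]⟩ := rfl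

end UniversalCover

/-! ### Spectral selectors -/

section Selectors

variable {E : Type*} [NormedAddCommGroup E] [NormedSpace ℝ E]
  {M : Type*} [TopologicalSpace M] [ChartedSpace E M] [IsManifold 𝓘(ℝ, E) ∞ M]

namespace ContactForm

variable (α : ContactForm E M)

/-- The universal cover of `Cont₀(M, ker α)`, the latter with the `C¹`-topology. -/
abbrev UniversalCont₀ : Type _ := UniversalCover α.Cont₀

/-- An `α`-spectral selector: a continuous function on the universal cover of `Cont₀(M, ker α)`
whose value at each element lies in the `α`-spectrum of its projection. -/
def IsSpectralSelector (c : α.UniversalCont₀ → ℝ) : Prop :=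
  Continuous c ∧ ∀ φ : α.UniversalCont₀, c φ ∈ α.spectrum φ.proj

/-- `φ` can be represented by a contact isotopy starting at the identity and supported in `U`. -/
def IsSupportedIn (φ : α.UniversalCont₀) (U : Set M) : Prop :=
  ∃ p : BasedPath α.Cont₀, UniversalCover.mk p = φ ∧
    α.IsContactIsotopy (fun t ↦ (p.1 t).1) ∧
    closure (⋃ t, closure {x | p.1 t x ≠ x}) ⊆ U

end ContactForm

end Selectors

end ContactSpectral

end

/-!
The argument has two halves.

*Displacement.* Represent `φ` by a path `p` supported in `U` and `ψ` by a path `q`, and let `p_s` be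
the path `t ↦ p (s t)`, which joins the constant path to `p`. If `x` is a discriminant point of
`Φ (-t) ∘ ψ ∘ p s`, then `x ∉ U`: otherwise `p s x ∈ U`, while `ψ (p s x) = Φ t x` lies in the
`α`-orbit of `U`, against displacement. Off `U` the map `p s` is the identity near `x`, so `x` is a
discriminant point of `Φ (-t) ∘ ψ` (`ContactForm.spectrum_comp_subset`). Hence the continuous
function `s ↦ c (ψ * [p_s])` takes all its values in the fixed set `Spec ψ`.

*The spectrum is null.* It remains to see that `Spec ψ` contains no interval, and in fact it has
measure zero (`ContactForm.volume_spectrum_eq_zero`). In a chart `e` around a point, let `a y` be the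
expression of `α` and consider
`f (t, y) = t + a y (e (Φ (-t) (ψ (e⁻¹ y))) - y)`.
At a pair `(t, y)` such that `e⁻¹ y` is a discriminant point of `Φ (-t) ∘ ψ`, the second summand
vanishes, so that `f (t, y) = t`, and moreover `(t, y)` is a critical point of `f`: the
`t`-derivative is `1 - α(R) = 0`, and the `y`-derivative is `(Φ (-t) ∘ ψ)^* α - α = 0`. So the
spectrum is covered by countably many sets of critical values of smooth real functions, which are
null by Sard's theorem (`volume_image_eq_zero_of_fderiv_eq_zero`).

Sard's theorem for real functions on a finite-dimensional space goes by induction on the dimension.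
Critical points where the derivatives of high enough order vanish have an image of Hausdorff
dimension less than `1`, since `f` is Hölder there with an exponent greater than the dimension. Near
any other critical point, the critical points lie in a smooth hypersurface, the zero set of a
combination of higher partial derivatives of `f`, and are critical for the restriction of `f` to it.

The Reeb flow enters the definitions through an existential quantifier, so its uniqueness and its
group property are also needed; both follow from the uniqueness of integral curves.
-/

namespace ContactSpectral

/-! ### Sard's theorem for real functions -/

section Sard

open MeasureTheory Metric Filter Module
open scoped Topology NNReal ENNReal

universe u

/-- A Taylor estimate: if all derivatives of `D` of order less than `k` vanish at `x`, then `D`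
vanishes at `x` to order `k`. -/
theorem norm_le_of_iteratedFDeriv_eq_zero {E : Type u} [NormedAddCommGroup E] [NormedSpace ℝ E]
    {k : ℕ} {F : Type u} [NormedAddCommGroup F] [NormedSpace ℝ F] {D : E → F} {x₀ : E} {r C : ℝ}
    (hD : ∀ y ∈ ball x₀ r, ContDiffAt ℝ k D y)
    (hC : ∀ y ∈ ball x₀ r, ‖iteratedFDeriv ℝ k D y‖ ≤ C) {x y : E} (hx : x ∈ ball x₀ r)
    (hy : y ∈ ball x₀ r) (h0 : ∀ i < k, iteratedFDeriv ℝ i D x = 0) :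
    ‖D y‖ ≤ C * ‖y - x‖ ^ k := by
  induction k generalizing F y with
  | zero => simpa using hC y hy
  | succ k ih =>
    have hCnn : 0 ≤ C := (norm_nonneg _).trans (hC x hx)
    have key : ∀ z ∈ ball x₀ r, ‖fderiv ℝ D z‖ ≤ C * ‖z - x‖ ^ k := by
      intro z hz
      refine ih (fun w hw ↦ (hD w hw).fderiv_right (by norm_cast)) ?_ hz ?_
      · intro w hw
        rw [norm_iteratedFDeriv_fderiv]
        exact hC w hw
      · intro i hi
        rw [← norm_eq_zero, norm_iteratedFDeriv_fderiv, h0 (i + 1) (by omega), norm_zero]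
    have hDx : D x = 0 := by
      rw [← norm_eq_zero, ← norm_iteratedFDeriv_zero (𝕜 := ℝ), h0 0 (by omega), norm_zero]
    have hseg : segment ℝ x y ⊆ ball x₀ r := (convex_ball x₀ r).segment_subset hx hy
    have := (convex_segment x y).norm_image_sub_le_of_norm_fderiv_le (𝕜 := ℝ) (f := D)
      (C := C * ‖y - x‖ ^ k)
      (fun z hz ↦ (hD z (hseg hz)).differentiableAt (by simp))
      (fun z hz ↦ (key z (hseg hz)).trans (by
        gcongr
        exact norm_sub_le_of_mem_segment hz))
      (left_mem_segment ℝ x y) (right_mem_segment ℝ x y)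
    rwa [hDx, sub_zero, mul_assoc, ← pow_succ] at this

variable {E : Type u} [NormedAddCommGroup E] [NormedSpace ℝ E] [FiniteDimensional ℝ E]

/-- The image of a set of points at which the derivatives of orders `1, …, k` of `f` vanish is null
if `k + 1` exceeds the dimension: `f` is locally Hölder on this set with exponent `k + 1`, so that
the Hausdorff dimension of the image is less than `1`. -/
theorem volume_image_eq_zero_of_flat {f : E → ℝ} {S : Set E} {k : ℕ} (hk : finrank ℝ E < k + 1)
    (hf : ∀ x ∈ S, ContDiffAt ℝ (k + 1 : ℕ) f x)
    (h0 : ∀ x ∈ S, ∀ i < k, iteratedFDeriv ℝ i (fderiv ℝ f) x = 0) :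
    volume (f '' S) = 0 := by
  have hdim : dimH (f '' S) ≤ dimH S / ((k + 1 : ℕ) : ℝ≥0) := by
    refine dimH_image_le_of_locally_holder_on (by positivity) fun x₀ hx₀ ↦ ?_
    have hD₀ : ContDiffAt ℝ k (fderiv ℝ f) x₀ := (hf x₀ hx₀).fderiv_right (by norm_cast)
    obtain ⟨C, hC⟩ : ∃ C : ℝ≥0, ∀ᶠ y in 𝓝 x₀, ‖iteratedFDeriv ℝ k (fderiv ℝ f) y‖ ≤ C := by
      have hcont : ContinuousAt (iteratedFDeriv ℝ k (fderiv ℝ f)) x₀ :=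
        (hD₀.iteratedFDeriv_right (m := 0) (by simp)).continuousAt
      refine ⟨‖iteratedFDeriv ℝ k (fderiv ℝ f) x₀‖₊ + 1, ?_⟩
      filter_upwards [hcont.norm.eventually_lt_const (lt_add_one _)] with y hy
      simpa using hy.le
    obtain ⟨r, hr, hball⟩ := Metric.eventually_nhds_iff_ball.1
      (hC.and ((hf x₀ hx₀).eventually (by simp)))
    refine ⟨C, ball x₀ r ∩ S, inter_mem (mem_nhdsWithin_of_mem_nhds (ball_mem_nhds _ hr))
      self_mem_nhdsWithin, ?_⟩
    have key : ∀ x ∈ ball x₀ r ∩ S, ∀ y ∈ ball x₀ r, ‖f y - f x‖ ≤ C * ‖y - x‖ ^ (k + 1) := by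
      intro x hx y hy
      have hseg : segment ℝ x y ⊆ ball x₀ r := (convex_ball x₀ r).segment_subset hx.1 hy
      have := (convex_segment x y).norm_image_sub_le_of_norm_fderiv_le (𝕜 := ℝ) (f := f)
        (C := C * ‖y - x‖ ^ k)
        (fun z hz ↦ (hball z (hseg hz)).2.differentiableAt (by simp))
        (fun z hz ↦ (norm_le_of_iteratedFDeriv_eq_zero (k := k) (D := fderiv ℝ f)
          (fun w hw ↦ (hball w hw).2.fderiv_right (by norm_cast)) (fun w hw ↦ (hball w hw).1)
          hx.1 (hseg hz) (h0 x hx.2)).trans (by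
            gcongr
            exact norm_sub_le_of_mem_segment hz))
        (left_mem_segment ℝ x y) (right_mem_segment ℝ x y)
      rwa [mul_assoc, ← pow_succ] at this
    intro x hx y hy
    have := key y hy x hx.1
    rw [← dist_eq_norm, ← dist_eq_norm] at this
    rw [edist_dist, edist_dist, NNReal.coe_natCast, ENNReal.rpow_natCast,
      ← ENNReal.ofReal_pow dist_nonneg, ← ENNReal.ofReal_coe_nnreal,
      ← ENNReal.ofReal_mul C.coe_nonneg]
    exact ENNReal.ofReal_le_ofReal this
  have hlt : dimH (f '' S) < (1 : ℝ≥0) := by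
    refine hdim.trans_lt ((ENNReal.div_lt_iff (by simp) (by simp)).2 ?_)
    refine (dimH_mono (Set.subset_univ S)).trans_lt ?_
    rw [Real.dimH_univ_eq_finrank]
    simpa using (by exact_mod_cast hk : (finrank ℝ E : ℝ≥0∞) < ((k + 1 : ℕ) : ℝ≥0∞))
  have := hausdorffMeasure_of_dimH_lt hlt
  rwa [NNReal.coe_one, hausdorffMeasure_real] at this

/-- A nonzero functional can be taken as the last coordinate. -/
theorem exists_continuousLinearEquiv_ker_prod {g' : E →L[ℝ] ℝ} (hg' : g' ≠ 0) :
    ∃ L : E ≃L[ℝ] (g'.ker × ℝ), ∀ x, (L x).2 = g' x := by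
  obtain ⟨p, hp⟩ := ContinuousLinearMap.ker_closedComplemented_of_finiteDimensional_range g'
  have hrank : finrank ℝ E = finrank ℝ (g'.ker × ℝ) := by
    rw [finrank_prod, finrank_self]
    exact (Module.Dual.finrank_ker_add_one_of_ne_zero (f := (g' : E →ₗ[ℝ] ℝ)) (by
      intro h
      exact hg' (ContinuousLinearMap.coe_injective h))).symm
  have hinj : Function.Injective (p.prod g' : E →ₗ[ℝ] (g'.ker × ℝ)) := by
    rw [← LinearMap.ker_eq_bot, LinearMap.ker_eq_bot']
    intro x hx
    have h1 : p x = 0 := congrArg Prod.fst hx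
    have h2 : g' x = 0 := congrArg Prod.snd hx
    have := hp ⟨x, h2⟩
    rw [h1] at this
    exact (congrArg Subtype.val this).symm
  refine ⟨(LinearEquiv.ofInjectiveOfFinrankEq _ hinj hrank).toContinuousLinearEquiv, fun x ↦ ?_⟩
  rfl

/-- The dimension reduction in Sard's theorem: the critical points of `f` that lie in a smooth
hypersurface `g = 0` have a null image near `x₀`, provided that Sard's theorem holds on the tangent
space of the hypersurface. The hypersurface is parametrized by its tangent space by means of the
inverse function theorem. -/
theorem exists_nhds_volume_image_eq_zero_of_hypersurface {f g : E → ℝ} {x₀ : E} {N M : ℕ}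
    (hM : M ≠ 0) (hNM : N ≤ M) (hf : ContDiffAt ℝ M f x₀) (hg : ContDiffAt ℝ M g x₀)
    (hg' : fderiv ℝ g x₀ ≠ 0)
    (hsard : ∀ (h : (fderiv ℝ g x₀).ker → ℝ) (T : Set (fderiv ℝ g x₀).ker),
      (∀ y ∈ T, ContDiffAt ℝ N h y ∧ fderiv ℝ h y = 0) → volume (h '' T) = 0) :
    ∃ u ∈ 𝓝 x₀, volume (f '' {x | x ∈ u ∧ g x = 0 ∧ fderiv ℝ f x = 0}) = 0 := by
  set F := (fderiv ℝ g x₀).ker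
  obtain ⟨L, hL⟩ : ∃ L : E ≃L[ℝ] F × ℝ, ∀ x, (L x).2 = fderiv ℝ g x₀ x :=
    exists_continuousLinearEquiv_ker_prod hg'
  set G : E → F × ℝ := fun x ↦ ((L x).1, g x)
  have hM' : ((M : ℕ∞) : ℕ∞ω) ≠ 0 := by exact_mod_cast hM
  have hG : ContDiffAt ℝ M G x₀ := (contDiff_fst.comp L.contDiff).contDiffAt.prodMk hg
  have hG' : HasFDerivAt G (L : E →L[ℝ] F × ℝ) x₀ := by
    have h1 : HasFDerivAt (fun x ↦ (L x).1)
        ((ContinuousLinearMap.fst ℝ F ℝ).comp (L : E →L[ℝ] F × ℝ)) x₀ :=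
      ((ContinuousLinearMap.fst ℝ F ℝ).comp (L : E →L[ℝ] F × ℝ)).hasFDerivAt
    have h2 := h1.prodMk (hg.differentiableAt hM').hasFDerivAt
    convert h2 using 1
    ext x
    · simp
    · simp [hL]
  set Ψ := hG.toOpenPartialHomeomorph G hG' hM'
  have hx₀ : x₀ ∈ Ψ.source := hG.mem_toOpenPartialHomeomorph_source hG' hM'
  have hΨ : ∀ x, Ψ x = G x := fun x ↦ rfl
  have hsymm : ContDiffAt ℝ M Ψ.symm (Ψ x₀) :=
    Ψ.contDiffAt_symm (f₀' := L) (Ψ.map_source hx₀) (by rwa [Ψ.left_inv hx₀])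
      (by rwa [Ψ.left_inv hx₀])
  set u : Set E := {x | x ∈ Ψ.source ∧ ContDiffAt ℝ M f x ∧ ContDiffAt ℝ M Ψ.symm (Ψ x)}
  have hu : u ∈ 𝓝 x₀ := by
    filter_upwards [Ψ.open_source.mem_nhds hx₀, hf.eventually (by simp),
      (Ψ.continuousAt hx₀).eventually (hsymm.eventually (by simp))] with x h1 h2 h3
    exact ⟨h1, h2, h3⟩
  refine ⟨u, hu, ?_⟩
  set K : Set E := {x | x ∈ u ∧ g x = 0 ∧ fderiv ℝ f x = 0}
  have hK : ∀ x ∈ K, Ψ.symm ((L x).1, 0) = x := by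
    rintro x ⟨hxu, hgx, -⟩
    have : Ψ x = ((L x).1, 0) := by rw [hΨ, ← hgx]
    rw [← this, Ψ.left_inv hxu.1]
  have himage : f '' K = (fun y : F ↦ f (Ψ.symm (y, 0))) '' ((fun x ↦ (L x).1) '' K) := by
    rw [Set.image_image]
    exact Set.image_congr fun x hx ↦ by rw [hK x hx]
  rw [himage]
  refine hsard _ _ ?_
  rintro _ ⟨x, hx, rfl⟩
  have hxΨ : Ψ x = ((L x).1, 0) := by rw [hΨ, ← hx.2.1]
  have hs : ContDiffAt ℝ M (fun y : F ↦ Ψ.symm (y, (0 : ℝ))) (L x).1 := by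
    have h3 := hx.1.2.2
    rw [hxΨ] at h3
    exact h3.comp (f := fun y : F ↦ (y, (0 : ℝ))) (L x).1 (contDiffAt_id.prodMk contDiffAt_const)
  have hfx : ContDiffAt ℝ M f (Ψ.symm ((L x).1, 0)) := by
    rw [hK x hx]
    exact hx.1.2.1
  refine ⟨(hfx.comp (L x).1 hs).of_le (by exact_mod_cast hNM), ?_⟩
  have hcomp := fderiv_fun_comp (f := fun y : F ↦ Ψ.symm (y, (0 : ℝ))) (L x).1
    (hfx.differentiableAt hM') (hs.differentiableAt hM')
  rw [hcomp, hK x hx, hx.2.2, ContinuousLinearMap.zero_comp]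

/-- Sard's theorem for real functions of some finite smoothness depending on the dimension only.
Finite smoothness, unlike `C^∞`, is an open condition at a point, which lets the induction work with
`ContDiffAt`; the order `N` obtained here is not optimal. -/
theorem exists_nat_sard (n : ℕ) : ∃ N : ℕ, ∀ (E : Type u) [NormedAddCommGroup E] [NormedSpace ℝ E]
    [FiniteDimensional ℝ E], finrank ℝ E = n → ∀ (f : E → ℝ) (S : Set E),
    (∀ x ∈ S, ContDiffAt ℝ N f x ∧ fderiv ℝ f x = 0) → volume (f '' S) = 0 := by
  induction n with
  | zero =>
    refine ⟨0, fun E _ _ _ hE f S _ ↦ ?_⟩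
    have : Subsingleton E := finrank_zero_iff.1 hE
    exact (S.subsingleton_of_subsingleton.image f).measure_zero _
  | succ n ih =>
    obtain ⟨N, hN⟩ := ih
    refine ⟨N + n + 3, fun E _ _ _ hE f S hS ↦ ?_⟩
    let D := fderiv ℝ f
    -- The critical points at which the `j`-th derivative of `D` vanishes and the next does not.
    let Z : ℕ → Set E := fun j ↦
      {x | x ∈ S ∧ iteratedFDeriv ℝ j D x = 0 ∧ iteratedFDeriv ℝ (j + 1) D x ≠ 0}
    have hcover : S ⊆ {x | x ∈ S ∧ ∀ i < n + 1, iteratedFDeriv ℝ i D x = 0} ∪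
        ⋃ j ∈ Finset.range n, Z j := by
      intro x hx
      by_cases h : ∀ i < n + 1, iteratedFDeriv ℝ i D x = 0
      · exact Or.inl ⟨hx, h⟩
      right
      by_contra hcon
      refine h fun i ↦ ?_
      induction i with
      | zero =>
        intro _
        rw [← norm_eq_zero, norm_iteratedFDeriv_zero, show D x = 0 from (hS x hx).2, norm_zero]
      | succ j ihj =>
        intro hj
        by_contra hne
        exact hcon (Set.mem_biUnion (Finset.mem_coe.2 (Finset.mem_range.2 (by omega : j < n)))
          ⟨hx, ihj (by omega), hne⟩)
    refine measure_mono_null (Set.image_mono hcover) ?_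
    rw [Set.image_union, Set.image_iUnion₂]
    refine measure_union_null ?_ ((measure_biUnion_null_iff (Finset.countable_toSet _)).2 ?_)
    · refine volume_image_eq_zero_of_flat (k := n + 1) (by omega) (fun x hx ↦ ?_)
        fun x hx ↦ hx.2
      exact (hS x hx.1).1.of_le (by norm_cast; omega)
    · intro j hj
      have hj' : j < n := Finset.mem_range.1 hj
      refine measure_null_of_locally_null (μ := OuterMeasure.comap f volume.toOuterMeasure) _ ?_
      rintro x₀ ⟨hx₀, -, hne⟩
      have hsm : ContDiffAt ℝ (N + 1 : ℕ) (iteratedFDeriv ℝ j D) x₀ :=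
        ((hS x₀ hx₀).1.fderiv_right (m := (N + 1 + j : ℕ)) (by norm_cast; omega)).iteratedFDeriv_right
          (by norm_cast)
      obtain ⟨w, hw⟩ : ∃ w, fderiv ℝ (iteratedFDeriv ℝ j D) x₀ w ≠ 0 := by
        by_contra! h
        refine hne (ContinuousMultilinearMap.ext fun m ↦ ?_)
        rw [iteratedFDeriv_succ_apply_left, h]
        rfl
      -- `l ∘ iteratedFDeriv ℝ j D` is a combination of partial derivatives of `f` that vanishes
      -- on `Z j` and has nonzero derivative at `x₀`.
      obtain ⟨l, hl⟩ := SeparatingDual.exists_ne_zero (R := ℝ) hw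
      have hgd : fderiv ℝ (fun x ↦ l (iteratedFDeriv ℝ j D x)) x₀ =
          l.comp (fderiv ℝ (iteratedFDeriv ℝ j D) x₀) :=
        (l.hasFDerivAt.comp x₀ (hsm.differentiableAt (by simp)).hasFDerivAt).fderiv
      have hg' : fderiv ℝ (fun x ↦ l (iteratedFDeriv ℝ j D x)) x₀ ≠ 0 := by
        intro h
        rw [hgd] at h
        exact hl (by simpa using DFunLike.congr_fun h w)
      have hrank : finrank ℝ (fderiv ℝ (fun x ↦ l (iteratedFDeriv ℝ j D x)) x₀).ker = n := by
        have := Module.Dual.finrank_ker_add_one_of_ne_zero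
          (f := (fderiv ℝ (fun x ↦ l (iteratedFDeriv ℝ j D x)) x₀ : E →ₗ[ℝ] ℝ))
          (fun h ↦ hg' (ContinuousLinearMap.coe_injective h))
        omega
      obtain ⟨u, hu, hvol⟩ := exists_nhds_volume_image_eq_zero_of_hypersurface (N := N)
        (M := N + 1) (f := f) (by omega) (by omega) ((hS x₀ hx₀).1.of_le (by norm_cast; omega))
        (l.contDiff.contDiffAt.comp x₀ hsm) hg' (fun h T hT ↦ hN _ hrank h T hT)
      refine ⟨u ∩ Z j, inter_mem (mem_nhdsWithin_of_mem_nhds hu) self_mem_nhdsWithin, ?_⟩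
      rw [OuterMeasure.comap_apply]
      refine measure_mono_null (Set.image_mono ?_) hvol
      rintro x ⟨hxu, hxS, h0, -⟩
      exact ⟨hxu, (congrArg l h0).trans l.map_zero, (hS x hxS).2⟩

/-- **Sard's theorem** for smooth real functions: the set of critical values is null. -/
theorem volume_image_eq_zero_of_fderiv_eq_zero {f : E → ℝ} {S : Set E}
    (hf : ∀ x ∈ S, ContDiffAt ℝ ∞ f x) (h0 : ∀ x ∈ S, fderiv ℝ f x = 0) :
    volume (f '' S) = 0 := by
  obtain ⟨N, hN⟩ := exists_nat_sard (finrank ℝ E)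
  exact hN E rfl f S fun x hx ↦ ⟨(hf x hx).of_le (by exact_mod_cast le_top), h0 x hx⟩

end Sard

/-! ### Uniqueness of the Reeb flow and smoothness of the contact form in charts -/

section Reeb

open scoped Topology

variable {E : Type*} [NormedAddCommGroup E] [NormedSpace ℝ E]
  {M : Type*} [TopologicalSpace M] [ChartedSpace E M] [IsManifold 𝓘(ℝ, E) ∞ M]

namespace ContactForm

variable {α : ContactForm E M}

omit [IsManifold 𝓘(ℝ, E) ∞ M] in
theorem extDerivForm_sub_left (β : ∀ x : M, TangentSpace 𝓘(ℝ, E) x →L[ℝ] ℝ) (x : M)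
    (v v' w : TangentSpace 𝓘(ℝ, E) x) :
    extDerivForm β x (v - v') w = extDerivForm β x v w - extDerivForm β x v' w := by
  let b : E →L[ℝ] E →L[ℝ] ℝ := fderiv ℝ (chartForm β x) (extChartAt 𝓘(ℝ, E) x x)
  let D : TangentSpace 𝓘(ℝ, E) x →L[ℝ] E :=
    mfderiv 𝓘(ℝ, E) 𝓘(ℝ, E) (extChartAt 𝓘(ℝ, E) x) x
  change b (D (v - v')) (D w) - b (D w) (D (v - v')) =
    (b (D v) (D w) - b (D w) (D v)) - (b (D v') (D w) - b (D w) (D v'))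
  rw [map_sub D, map_sub b, map_sub (b (D w)), sub_apply]
  ring

theorem IsReebField.unique {R R' : ∀ x : M, TangentSpace 𝓘(ℝ, E) x} (hR : α.IsReebField R)
    (hR' : α.IsReebField R') : R = R' := by
  funext x
  refine sub_eq_zero.1 (α.nondegenerate x _ ?_ fun w _ ↦ ?_)
  · rw [map_sub, (hR x).1, (hR' x).1, sub_self]
  · rw [extDerivForm_sub_left, (hR x).2 w, (hR' x).2 w, sub_self]

/-- The vector field generating a smooth flow is `C^1`, being the velocity of the flow at time `0`. -/
theorem contMDiff_velocity {Φ : ℝ → M → M}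
    (hΦ : ContMDiff (𝓘(ℝ, ℝ).prod 𝓘(ℝ, E)) 𝓘(ℝ, E) ∞ (fun p : ℝ × M ↦ Φ p.1 p.2))
    (h0 : ∀ x, Φ 0 x = x) {R : ∀ x : M, TangentSpace 𝓘(ℝ, E) x}
    (hR : ∀ x, IsMIntegralCurve (I := 𝓘(ℝ, E)) (fun t ↦ Φ t x) R) :
    ContMDiff 𝓘(ℝ, E) 𝓘(ℝ, E).tangent 1
      (fun x ↦ (⟨x, R x⟩ : TangentBundle 𝓘(ℝ, E) M)) := by
  have : IsManifold 𝓘(ℝ, E) 1 M := .of_le (n := ∞) (by simp)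
  have : IsManifold 𝓘(ℝ, E) (1 + 1) M := .of_le (n := ∞) (by norm_cast)
  have hT := hΦ.contMDiff_tangentMap (m := 1) (by norm_cast)
  have hsec : ContMDiff 𝓘(ℝ, E) (𝓘(ℝ, ℝ).prod 𝓘(ℝ, E)).tangent 1
      (fun x : M ↦ (equivTangentBundleProd 𝓘(ℝ, ℝ) ℝ 𝓘(ℝ, E) M).symm
        ((⟨0, (1 : ℝ)⟩ : TangentBundle 𝓘(ℝ, ℝ) ℝ), ⟨x, 0⟩)) :=
    (contMDiff_equivTangentBundleProd_symm (n := 1)).comp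
      (contMDiff_const.prodMk (Bundle.contMDiff_zeroSection ℝ (TangentSpace 𝓘(ℝ, E))))
  convert hT.comp hsec using 1
  funext x
  have h1 := hR x 0
  have h2 : HasMFDerivAt 𝓘(ℝ, ℝ) (𝓘(ℝ, ℝ).prod 𝓘(ℝ, E)) (fun t : ℝ ↦ (t, x)) 0
      ((ContinuousLinearMap.id ℝ ℝ).prod (0 : ℝ →L[ℝ] E)) :=
    (hasMFDerivAt_id 0).prodMk (hasMFDerivAt_const x 0)
  have h3 := ((hΦ.mdifferentiable (by simp)) (0, x)).hasMFDerivAt.comp 0 h2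
  have h4 := hasMFDerivAt_unique h1 h3
  have h5 := DFunLike.congr_fun h4 (1 : ℝ)
  have h6 : R (Φ 0 x) = mfderiv (𝓘(ℝ, ℝ).prod 𝓘(ℝ, E)) 𝓘(ℝ, E) (fun p : ℝ × M ↦ Φ p.1 p.2)
      (0, x) ((1 : ℝ), (0 : E)) := by
    refine Eq.trans ?_ h5
    exact (one_smul ℝ (R (Φ 0 x))).symm
  refine (congrArg (fun z : M ↦ (⟨z, R z⟩ : TangentBundle 𝓘(ℝ, E) M)) (h0 x)).symm.trans ?_
  rw [h6]
  rfl

theorem IsReebFlow.add [T2Space M] {Φ : ℝ → M → M} (hΦ : α.IsReebFlow Φ) (s t : ℝ) (x : M) :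
    Φ (s + t) x = Φ s (Φ t x) := by
  obtain ⟨hsm, h0, R, -, hR⟩ := hΦ
  have : IsManifold 𝓘(ℝ, E) 1 M := .of_le (n := ∞) (by simp)
  exact congrFun (isMIntegralCurve_Ioo_eq_of_contMDiff_boundaryless (t₀ := 0)
    (contMDiff_velocity hsm h0 hR) ((hR x).comp_add t) (hR (Φ t x)) (by simp [h0])) s

theorem IsReebFlow.unique [T2Space M] {Φ Φ' : ℝ → M → M} (hΦ : α.IsReebFlow Φ)
    (hΦ' : α.IsReebFlow Φ') : Φ = Φ' := by
  obtain ⟨hsm, h0, R, hR, hc⟩ := hΦ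
  obtain ⟨-, h0', R', hR', hc'⟩ := hΦ'
  obtain rfl := hR.unique hR'
  have : IsManifold 𝓘(ℝ, E) 1 M := .of_le (n := ∞) (by simp)
  funext t x
  exact congrFun (isMIntegralCurve_Ioo_eq_of_contMDiff_boundaryless (t₀ := 0)
    (contMDiff_velocity hsm h0 hc) (hc x) (hc' x) (by rw [h0, h0'])) t

theorem contDiffAt_chartForm (α : ContactForm E M) (x₀ : M) {y : E}
    (hy : y ∈ (extChartAt 𝓘(ℝ, E) x₀).target) :
    ContDiffAt ℝ ∞ (chartForm α.toFun x₀) y := by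
  have : IsManifold 𝓘(ℝ, E) 1 M := .of_le (n := ∞) (by simp)
  set p := (extChartAt 𝓘(ℝ, E) x₀).symm y with hp
  have hps : p ∈ (extChartAt 𝓘(ℝ, E) x₀).source := (extChartAt 𝓘(ℝ, E) x₀).map_target hy
  let T := trivializationAt (E →L[ℝ] ℝ)
    (fun x : M ↦ TangentSpace 𝓘(ℝ, E) x →L[ℝ] Bundle.Trivial M ℝ x) x₀
  have h1 := (Bundle.Trivialization.contMDiffAt_iff (IB := 𝓘(ℝ, E)) (e := T) (n := ∞)
    (x₀ := p) (f := fun x : M ↦ Bundle.TotalSpace.mk' (E →L[ℝ] ℝ)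
      (E := fun x : M ↦ TangentSpace 𝓘(ℝ, E) x →L[ℝ] Bundle.Trivial M ℝ x) x (α.toFun x)) (by
      rw [hom_trivializationAt_source]
      exact ⟨by simpa using hps, Set.mem_univ _⟩)).1 (α.smooth p)
  have h2 : ContMDiffAt 𝓘(ℝ, E) 𝓘(ℝ, E) ∞ (extChartAt 𝓘(ℝ, E) x₀).symm y :=
    (contMDiffOn_extChartAt_symm x₀).contMDiffAt ((isOpen_extChartAt_target x₀).mem_nhds hy)
  have h3 : ContDiffAt ℝ ∞ (fun z : E ↦ (T (Bundle.TotalSpace.mk' (E →L[ℝ] ℝ)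
      (E := fun x : M ↦ TangentSpace 𝓘(ℝ, E) x →L[ℝ] Bundle.Trivial M ℝ x)
      ((extChartAt 𝓘(ℝ, E) x₀).symm z) (α.toFun ((extChartAt 𝓘(ℝ, E) x₀).symm z)))).2) y :=
    (h1.2.comp y h2).contDiffAt
  refine h3.congr_of_eventuallyEq ?_
  filter_upwards [(isOpen_extChartAt_target x₀).mem_nhds hy] with z hz
  have hzs : (extChartAt 𝓘(ℝ, E) x₀).symm z ∈ (chartAt E x₀).source := by
    simpa using (extChartAt 𝓘(ℝ, E) x₀).map_target hz
  have hsymmL := TangentBundle.symmL_trivializationAt (𝕜 := ℝ) (I := 𝓘(ℝ, E)) hzs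
  rw [(extChartAt 𝓘(ℝ, E) x₀).right_inv hz] at hsymmL
  simp only [modelWithCornersSelf_coe, Set.range_id, mfderivWithin_univ] at hsymmL
  simp only [T]
  rw [hom_trivializationAt_apply]
  simp only [ContinuousLinearMap.inCoordinates]
  rw [hsymmL]
  ext v
  simp [chartForm]
end ContactForm
end Reeb

/-! ### The spectrum has measure zero -/

section SpectrumNull

open scoped Topology
open MeasureTheory

variable {E : Type*} [NormedAddCommGroup E] [NormedSpace ℝ E]
  {M : Type*} [TopologicalSpace M] [ChartedSpace E M] [IsManifold 𝓘(ℝ, E) ∞ M]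

namespace ContactForm

/-- The function `(t, y) ↦ t + a y (e (Φ (-t) (ψ (e⁻¹ y))) - y)`, where `e` is the chart around `x₀`
and `a` the expression of `α` in it. It has a critical point, with critical value `t`, wherever
`e⁻¹ y` is a discriminant point of `Φ (-t) ∘ ψ`. -/
noncomputable def localAction (α : ContactForm E M) (Φ : ℝ → M → M) (ψ : M → M) (x₀ : M) (z : ℝ × E) : ℝ :=
  z.1 + chartForm α.toFun x₀ z.2 (extChartAt 𝓘(ℝ, E) x₀
    (Φ (-z.1) (ψ ((extChartAt 𝓘(ℝ, E) x₀).symm z.2))) - z.2)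

variable {α : ContactForm E M} {Φ : ℝ → M → M} {ψ : M → M} {x₀ : M} {t : ℝ} {y : E}

theorem contDiffAt_localAction
    (hΦ : ContMDiff (𝓘(ℝ, ℝ).prod 𝓘(ℝ, E)) 𝓘(ℝ, E) ∞ (fun p : ℝ × M ↦ Φ p.1 p.2))
    (hψ : ContMDiff 𝓘(ℝ, E) 𝓘(ℝ, E) ∞ ψ) (hy : y ∈ (extChartAt 𝓘(ℝ, E) x₀).target)
    (hs : Φ (-t) (ψ ((extChartAt 𝓘(ℝ, E) x₀).symm y)) ∈ (extChartAt 𝓘(ℝ, E) x₀).source) :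
    ContDiffAt ℝ ∞ (localAction α Φ ψ x₀) (t, y) := by
  have he : ContMDiffAt 𝓘(ℝ, E) 𝓘(ℝ, E) ∞ (extChartAt 𝓘(ℝ, E) x₀).symm y :=
    (contMDiffOn_extChartAt_symm x₀).contMDiffAt ((isOpen_extChartAt_target x₀).mem_nhds hy)
  have he' : ContMDiffAt 𝓘(ℝ, E) 𝓘(ℝ, E) ∞ (extChartAt 𝓘(ℝ, E) x₀)
      (Φ (-t) (ψ ((extChartAt 𝓘(ℝ, E) x₀).symm y))) :=
    contMDiffAt_extChartAt' (by simpa using hs)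
  have h1 : ContMDiffAt 𝓘(ℝ, ℝ × E) 𝓘(ℝ, ℝ) ∞ (fun z : ℝ × E ↦ -z.1) (t, y) :=
    contDiff_fst.neg.contDiffAt.contMDiffAt
  have h2 : ContMDiffAt 𝓘(ℝ, ℝ × E) 𝓘(ℝ, E) ∞ (fun z : ℝ × E ↦ z.2) (t, y) :=
    contDiff_snd.contDiffAt.contMDiffAt
  have h3 : ContMDiffAt 𝓘(ℝ, ℝ × E) 𝓘(ℝ, E) ∞
      (fun z : ℝ × E ↦ ψ ((extChartAt 𝓘(ℝ, E) x₀).symm z.2)) (t, y) :=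
    (hψ _).comp (t, y) (he.comp (t, y) h2)
  have h4 : ContMDiffAt 𝓘(ℝ, ℝ × E) 𝓘(ℝ, E) ∞
      (fun z : ℝ × E ↦ Φ (-z.1) (ψ ((extChartAt 𝓘(ℝ, E) x₀).symm z.2))) (t, y) :=
    (hΦ _).comp (t, y) (h1.prodMk h3)
  have h5 : ContDiffAt ℝ ∞ (fun z : ℝ × E ↦ extChartAt 𝓘(ℝ, E) x₀
      (Φ (-z.1) (ψ ((extChartAt 𝓘(ℝ, E) x₀).symm z.2)))) (t, y) :=
    (ContMDiffAt.comp (t, y) he' h4).contDiffAt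
  have h6 : ContDiffAt ℝ ∞ (fun z : ℝ × E ↦ chartForm α.toFun x₀ z.2) (t, y) :=
    (contDiffAt_chartForm α x₀ hy).comp (t, y) contDiffAt_snd
  exact contDiffAt_fst.add (h6.clm_apply (h5.sub contDiffAt_snd))

/-- Pulling `β` back to the chart and then forward again gives `β`. -/
theorem chartForm_mfderiv_extChartAt (β : ∀ x : M, TangentSpace 𝓘(ℝ, E) x →L[ℝ] ℝ)
    (hy : y ∈ (extChartAt 𝓘(ℝ, E) x₀).target)
    (v : TangentSpace 𝓘(ℝ, E) ((extChartAt 𝓘(ℝ, E) x₀).symm y)) :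
    chartForm β x₀ y (mfderiv 𝓘(ℝ, E) 𝓘(ℝ, E) (extChartAt 𝓘(ℝ, E) x₀)
      ((extChartAt 𝓘(ℝ, E) x₀).symm y) v) = β ((extChartAt 𝓘(ℝ, E) x₀).symm y) v := by
  have : IsManifold 𝓘(ℝ, E) 1 M := .of_le (n := ∞) (by simp)
  have h := mfderivWithin_extChartAt_symm_comp_mfderiv_extChartAt (I := 𝓘(ℝ, E)) (x := x₀) hy
  simp only [modelWithCornersSelf_coe, Set.range_id, mfderivWithin_univ] at h
  exact congrArg (β ((extChartAt 𝓘(ℝ, E) x₀).symm y)) (DFunLike.congr_fun h v)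

theorem fderiv_localAction_eq_zero (hΦ : α.IsReebFlow Φ)
    (hψ : ContMDiff 𝓘(ℝ, E) 𝓘(ℝ, E) ∞ ψ) (hy : y ∈ (extChartAt 𝓘(ℝ, E) x₀).target)
    (hp : α.IsDiscriminantPoint (Φ (-t) ∘ ψ) ((extChartAt 𝓘(ℝ, E) x₀).symm y)) :
    fderiv ℝ (localAction α Φ ψ x₀) (t, y) = 0 := by
  obtain ⟨hΦs, -, R, hR, hc⟩ := hΦ
  have : IsManifold 𝓘(ℝ, E) 1 M := .of_le (n := ∞) (by simp)
  obtain ⟨hfix, hα⟩ := hp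
  have hyp := (extChartAt 𝓘(ℝ, E) x₀).right_inv hy
  have hps := (extChartAt 𝓘(ℝ, E) x₀).map_target hy
  have hchart := chartForm_mfderiv_extChartAt (x₀ := x₀) α.toFun hy
  have hes : MDifferentiableAt 𝓘(ℝ, E) 𝓘(ℝ, E) (extChartAt 𝓘(ℝ, E) x₀).symm y :=
    ((contMDiffOn_extChartAt_symm (n := 1) x₀).contMDiffAt
      ((isOpen_extChartAt_target x₀).mem_nhds hy)).mdifferentiableAt one_ne_zero
  set p := (extChartAt 𝓘(ℝ, E) x₀).symm y with hpdef
  have hfix' : Φ (-t) (ψ p) = p := hfix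
  have he : HasMFDerivAt 𝓘(ℝ, E) 𝓘(ℝ, E) (extChartAt 𝓘(ℝ, E) x₀) p
      (mfderiv 𝓘(ℝ, E) 𝓘(ℝ, E) (extChartAt 𝓘(ℝ, E) x₀) p) :=
    (mdifferentiableAt_extChartAt (by simpa using hps)).hasMFDerivAt
  -- The same maps with their types read in the model space, so that the base point `Φ (-t) (ψ p)`
  -- can be rewritten as `p`.
  let αE : M → E →L[ℝ] ℝ := α.toFun
  let a : E → E →L[ℝ] ℝ := chartForm α.toFun x₀
  let De : E →L[ℝ] E := mfderiv 𝓘(ℝ, E) 𝓘(ℝ, E) (extChartAt 𝓘(ℝ, E) x₀) p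
  let De' : E →L[ℝ] E := mfderiv 𝓘(ℝ, E) 𝓘(ℝ, E) (extChartAt 𝓘(ℝ, E) x₀).symm y
  let DF : E →L[ℝ] E := mfderiv 𝓘(ℝ, E) 𝓘(ℝ, E) (Φ (-t) ∘ ψ) p
  have ha' : ∀ v : E, a y v = αE p (De' v) := fun v ↦ rfl
  have haDe : ∀ v : E, a y (De v) = αE p v := hchart
  have hαF : ∀ v : E, αE p (DF v) = αE p v := by
    intro v
    have h : αE (Φ (-t) (ψ p)) (DF v) = αE p v := DFunLike.congr_fun hα v
    rwa [hfix'] at h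
  -- The derivative in `t` is `1 - α(R)`.
  have htime : HasDerivAt (fun s ↦ localAction α Φ ψ x₀ (s, y)) 0 t := by
    let RE : M → E := R
    have hRE : αE p (RE p) = 1 := (hR p).1
    have h1 : HasMFDerivAt 𝓘(ℝ, ℝ) 𝓘(ℝ, E) (fun s ↦ Φ s (ψ p)) (-t)
        ((1 : ℝ →L[ℝ] ℝ).smulRight (RE (Φ (-t) (ψ p)))) := hc (ψ p) (-t)
    have h2 : HasMFDerivAt 𝓘(ℝ, E) 𝓘(ℝ, E) (extChartAt 𝓘(ℝ, E) x₀) (Φ (-t) (ψ p)) De := by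
      rw [hfix']
      exact he
    have hneg : HasMFDerivAt 𝓘(ℝ, ℝ) 𝓘(ℝ, ℝ) (fun s : ℝ ↦ -s) t (-ContinuousLinearMap.id ℝ ℝ) :=
      (hasFDerivAt_id t).neg.hasMFDerivAt
    have h3' : HasFDerivAt (fun s ↦ extChartAt 𝓘(ℝ, E) x₀ (Φ (-s) (ψ p)))
        (De.comp (((1 : ℝ →L[ℝ] ℝ).smulRight (RE (Φ (-t) (ψ p)))).comp
          (-ContinuousLinearMap.id ℝ ℝ))) t :=
      (HasMFDerivAt.comp t h2 (HasMFDerivAt.comp t h1 hneg)).hasFDerivAt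
    have h3 : HasDerivAt (fun s ↦ extChartAt 𝓘(ℝ, E) x₀ (Φ (-s) (ψ p)))
        (De ((-1 : ℝ) • RE (Φ (-t) (ψ p)))) t :=
      h3'.hasDerivAt.congr_deriv (by simp)
    have h4 : HasDerivAt (fun s ↦ s + a y (extChartAt 𝓘(ℝ, E) x₀ (Φ (-s) (ψ p)) - y))
        (1 + a y (De ((-1 : ℝ) • RE (Φ (-t) (ψ p))))) t :=
      (hasDerivAt_id t).add ((a y).hasFDerivAt.comp_hasDerivAt t (h3.sub_const y))
    rw [hfix', haDe, map_smul, hRE, smul_eq_mul, mul_one, add_neg_cancel] at h4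
    exact h4
  -- The derivative in `y` is `(Φ (-t) ∘ ψ)^* α - α`, as the factor of `a'` vanishes at `y`.
  have hspace : HasFDerivAt (fun w ↦ localAction α Φ ψ x₀ (t, w)) (0 : E →L[ℝ] ℝ) y := by
    have h1 : MDifferentiableAt 𝓘(ℝ, E) 𝓘(ℝ, E) (Φ (-t) ∘ ψ) p := by
      have : ContMDiff 𝓘(ℝ, E) 𝓘(ℝ, E) ∞ (Φ (-t) ∘ ψ) :=
        hΦs.comp ((contMDiff_const (c := -t)).prodMk hψ)
      exact this.mdifferentiable (by simp) p
    have h2 : HasMFDerivAt 𝓘(ℝ, E) 𝓘(ℝ, E) (extChartAt 𝓘(ℝ, E) x₀) ((Φ (-t) ∘ ψ) p) De := by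
      rw [hfix]
      exact he
    have h3 : HasFDerivAt (fun w ↦ extChartAt 𝓘(ℝ, E) x₀
        (Φ (-t) (ψ ((extChartAt 𝓘(ℝ, E) x₀).symm w)))) (De.comp (DF.comp De')) y :=
      (HasMFDerivAt.comp y (HasMFDerivAt.comp p h2 h1.hasMFDerivAt) hes.hasMFDerivAt).hasFDerivAt
    have ha : HasFDerivAt a (fderiv ℝ a y) y :=
      ((contDiffAt_chartForm α x₀ hy).differentiableAt (by simp)).hasFDerivAt
    have h0 : extChartAt 𝓘(ℝ, E) x₀ (Φ (-t) (ψ ((extChartAt 𝓘(ℝ, E) x₀).symm y))) - y = 0 := by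
      rw [← hpdef, hfix', hyp, sub_self]
    have h4 : HasFDerivAt (fun w ↦ localAction α Φ ψ x₀ (t, w)) _ y :=
      (ha.clm_apply (h3.sub (hasFDerivAt_id y))).const_add t
    refine h4.congr_fderiv ?_
    ext v
    simp only [Pi.sub_apply, id]
    rw [h0]
    simp [haDe, hαF, ha']
  have hd : DifferentiableAt ℝ (localAction α Φ ψ x₀) (t, y) :=
    (contDiffAt_localAction hΦs hψ hy (by rw [← hpdef, hfix']; exact hps)).differentiableAt
      (by simp)
  have h1 : HasFDerivAt (fun s ↦ localAction α Φ ψ x₀ (s, y)) _ t :=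
    HasFDerivAt.comp (g := localAction α Φ ψ x₀) t hd.hasFDerivAt (hasFDerivAt_prodMk_left t y)
  have h2 : HasFDerivAt (fun w ↦ localAction α Φ ψ x₀ (t, w)) _ y :=
    HasFDerivAt.comp (g := localAction α Φ ψ x₀) y hd.hasFDerivAt (hasFDerivAt_prodMk_right t y)
  ext v
  · simpa using DFunLike.congr_fun (h1.unique htime.hasFDerivAt) 1
  · simpa using DFunLike.congr_fun (h2.unique hspace) v

/-- The spectrum of a smooth map has measure zero, as it is covered by countably many sets of
critical values of smooth functions. -/
theorem volume_spectrum_eq_zero [FiniteDimensional ℝ E] [T2Space M] [CompactSpace M]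
    (α : ContactForm E M) {ψ : M → M} (hψ : ContMDiff 𝓘(ℝ, E) 𝓘(ℝ, E) ∞ ψ) :
    volume (α.spectrum ψ) = 0 := by
  by_cases hex : ∃ Φ, α.IsReebFlow Φ
  swap
  · have : α.spectrum ψ = ∅ := by
      ext t
      exact iff_of_false (fun ⟨Φ, hΦ, _⟩ ↦ hex ⟨Φ, hΦ⟩) (Set.notMem_empty t)
    rw [this, measure_empty]
  obtain ⟨Φ, hΦ⟩ := hex
  have : SecondCountableTopology M := ChartedSpace.secondCountable_of_sigmaCompact E M
  let K : Set (ℝ × M) := {q | α.IsDiscriminantPoint (Φ (-q.1) ∘ ψ) q.2}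
  have hK : α.spectrum ψ ⊆ Prod.fst '' K := by
    rintro t ⟨Φ', hΦ', x, hx⟩
    obtain rfl := hΦ.unique hΦ'
    exact ⟨(t, x), hx, rfl⟩
  refine measure_mono_null hK ?_
  refine measure_null_of_locally_null
    (μ := OuterMeasure.comap (Prod.fst : ℝ × M → ℝ) volume.toOuterMeasure) K ?_
  rintro ⟨t₀, x₀⟩ -
  let e := extChartAt 𝓘(ℝ, E) x₀
  let S : Set (ℝ × E) := {z | z.2 ∈ e.target ∧ (z.1, e.symm z.2) ∈ K}
  have hS : volume (localAction α Φ ψ x₀ '' S) = 0 := by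
    refine volume_image_eq_zero_of_fderiv_eq_zero (fun z hz ↦ ?_) fun z hz ↦ ?_
    · refine contDiffAt_localAction hΦ.1 hψ hz.1 ?_
      have h : Φ (-z.1) (ψ (e.symm z.2)) = e.symm z.2 := hz.2.1
      rw [h]
      exact e.map_target hz.1
    · exact fderiv_localAction_eq_zero hΦ hψ hz.1 hz.2
  refine ⟨{q | q.2 ∈ e.source} ∩ K, Filter.inter_mem (mem_nhdsWithin_of_mem_nhds ?_)
    self_mem_nhdsWithin, ?_⟩
  · exact continuous_snd.continuousAt (extChartAt_source_mem_nhds x₀)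
  rw [OuterMeasure.comap_apply]
  refine measure_mono_null ?_ hS
  rintro _ ⟨⟨t, x⟩, ⟨hx, hxK⟩, rfl⟩
  have hinv : e.symm (e x) = x := e.left_inv hx
  refine ⟨(t, e x), ⟨e.map_source hx, by rwa [hinv]⟩, ?_⟩
  have h : Φ (-t) (ψ x) = x := hxK.1
  change t + chartForm α.toFun x₀ (e x) (e (Φ (-t) (ψ (e.symm (e x)))) - e x) = t
  rw [hinv, h, sub_self, map_zero, add_zero]

end ContactForm

end SpectrumNull

/-! ### Displacement, and the contraction of a path to its starting point -/

section Selectors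

open scoped Topology
open MeasureTheory

namespace UniversalCover

variable {X : Type*} [TopologicalSpace X] [Monoid X] [ContinuousMul X]

/-- The initial piece `t ↦ p (s t)` of a path `p`, reparametrized to `[0, 1]`. -/
def shrink {X : Type*} [TopologicalSpace X] [One X] (p : BasedPath X) (s : unitInterval) :
    BasedPath X :=
  ⟨⟨fun t ↦ p.1 (s * t), by fun_prop⟩, by simp [p.2]⟩

theorem continuous_mk_mul_mk_shrink (q p : BasedPath X) :
    Continuous fun s ↦ mk q * mk (shrink p s) := by
  have h : Continuous fun s : unitInterval ↦ q.1 * (shrink p s).1 := by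
    refine continuous_const.mul (ContinuousMap.continuous_of_continuous_uncurry _ ?_)
    change Continuous fun z : unitInterval × unitInterval ↦ p.1 (z.1 * z.2)
    fun_prop
  have h' : Continuous fun s : unitInterval ↦
      (⟨q.1 * (shrink p s).1, by simp [q.2, (shrink p s).2]⟩ : BasedPath X) :=
    h.subtype_mk _
  exact continuous_quot_mk.comp h'

omit [ContinuousMul X] in
theorem shrink_one (p : BasedPath X) : shrink p 1 = p := by
  ext t
  simp [shrink]

theorem mk_mul_mk_shrink_zero (q p : BasedPath X) : mk q * mk (shrink p 0) = mk q := by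
  rw [mk_mul_mk]
  congr 1
  ext t
  simp [shrink, p.2]

end UniversalCover

theorem subsingleton_of_isPreconnected_of_volume_eq_zero {s : Set ℝ} (hs : IsPreconnected s)
    (h0 : volume s = 0) : s.Subsingleton := by
  have key : ∀ x ∈ s, ∀ y ∈ s, y ≤ x := by
    intro x hx y hy
    have := measure_mono_null (hs.Icc_subset hx hy) h0
    rwa [Real.volume_Icc, ENNReal.ofReal_eq_zero, sub_nonpos] at this
  exact fun x hx y hy ↦ le_antisymm (key y hy x hx) (key x hx y hy)

namespace ContactForm

variable {E : Type*} [NormedAddCommGroup E] [NormedSpace ℝ E]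
  {M : Type*} [TopologicalSpace M] [ChartedSpace E M] [IsManifold 𝓘(ℝ, E) ∞ M]

variable {α : ContactForm E M}

theorem IsReebFlow.apply_apply_neg [T2Space M] {Φ : ℝ → M → M} (hΦ : α.IsReebFlow Φ) (t : ℝ)
    (x : M) :
    Φ t (Φ (-t) x) = x := by
  rw [← hΦ.add, add_neg_cancel, hΦ.2.1]

/-- Composing on the right with a map supported in a set that `ψ` displaces creates no new spectral
values: a discriminant point of `Φ (-t) ∘ ψ ∘ φ` lies outside `U`, where `φ` is locally the
identity. -/
theorem spectrum_comp_subset [T2Space M] {φ ψ : M → M} {U : Set M}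
    (hφinj : Function.Injective φ) (hφ : closure {x | φ x ≠ x} ⊆ U) (hψ : α.Displaces ψ U) :
    α.spectrum (ψ ∘ φ) ⊆ α.spectrum ψ := by
  rintro t ⟨Φ, hΦ, x, hfix, hx⟩
  have hfix' : Φ (-t) (ψ (φ x)) = x := hfix
  have hxU : x ∉ U := by
    intro hxU
    have hφx : φ x ∈ U := by
      by_cases h : φ x = x
      · rwa [h]
      · exact hφ (subset_closure fun h' ↦ h (hφinj h'))
    have h1 : ψ (φ x) ∈ ψ '' α.orbit U :=
      Set.mem_image_of_mem ψ ⟨Φ, hΦ, 0, φ x, hφx, (hΦ.2.1 _).symm⟩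
    have h2 : ψ (φ x) ∈ α.orbit U := by
      refine ⟨Φ, hΦ, t, x, hxU, ?_⟩
      conv_rhs => rw [← hfix']
      exact (hΦ.apply_apply_neg t _).symm
    exact (Set.ext_iff.1 hψ (ψ (φ x))).1 ⟨h1, h2⟩
  have hev : φ =ᶠ[𝓝 x] id := by
    filter_upwards [isClosed_closure.isOpen_compl.mem_nhds fun h ↦ hxU (hφ h)] with y hy
    by_contra h
    exact hy (subset_closure h)
  have hev' : Φ (-t) ∘ ψ ∘ φ =ᶠ[𝓝 x] Φ (-t) ∘ ψ := hev.fun_comp (Φ (-t) ∘ ψ)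
  refine ⟨Φ, hΦ, x, hev'.eq_of_nhds ▸ hfix, ?_⟩
  rw [hev'.eq_of_nhds, hev'.mfderiv_eq] at hx
  exact hx

end ContactForm
end Selectors

end ContactSpectral

theorem proposition5p3 {E : Type*} [NormedAddCommGroup E] [NormedSpace ℝ E] [FiniteDimensional ℝ E]
    {M : Type*} [TopologicalSpace M] [T2Space M] [CompactSpace M]
    [ChartedSpace E M] [IsManifold 𝓘(ℝ, E) ∞ M]
    (α : ContactSpectral.ContactForm E M)
    (c : α.UniversalCont₀ → ℝ) (hc : α.IsSpectralSelector c)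
    (U : Set M) (hU : IsOpen U) (hUne : U.Nonempty)
    (φ ψ : α.UniversalCont₀)
    (hφ : α.IsSupportedIn φ U) (hψ : α.Displaces ψ.proj U) :
    c (ψ * φ) = c ψ := by
  obtain ⟨p, rfl, -, hp⟩ := hφ
  obtain ⟨q, rfl⟩ : ∃ q, ContactSpectral.UniversalCover.mk q = ψ := Quotient.exists_rep ψ
  let g : unitInterval → ℝ := fun s ↦ c (ContactSpectral.UniversalCover.mk q *
    ContactSpectral.UniversalCover.mk (ContactSpectral.UniversalCover.shrink p s))
  have hcont : Continuous g :=
    hc.1.comp (ContactSpectral.UniversalCover.continuous_mk_mul_mk_shrink q p)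
  have hmem : ∀ s, g s ∈ α.spectrum (q.1 1) := by
    intro s
    have h1 := hc.2 (ContactSpectral.UniversalCover.mk q *
      ContactSpectral.UniversalCover.mk (ContactSpectral.UniversalCover.shrink p s))
    have h2 : (ContactSpectral.UniversalCover.mk q * ContactSpectral.UniversalCover.mk
        (ContactSpectral.UniversalCover.shrink p s)).proj = q.1 1 * p.1 s := by
      change q.1 1 * p.1 (s * 1) = _
      rw [mul_one]
    rw [h2] at h1
    refine ContactSpectral.ContactForm.spectrum_comp_subset (p.1 s).1.injective ?_ hψ h1
    exact (Set.subset_iUnion (fun t ↦ closure {x | p.1 t x ≠ x}) s).trans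
      (subset_closure.trans hp)
  have hsub : (Set.range g).Subsingleton :=
    ContactSpectral.subsingleton_of_isPreconnected_of_volume_eq_zero
      (isPreconnected_range hcont)
      (MeasureTheory.measure_mono_null (Set.range_subset_iff.2 hmem)
        (α.volume_spectrum_eq_zero (q.1 1).1.contMDiff))
  have h : g 1 = g 0 := hsub ⟨1, rfl⟩ ⟨0, rfl⟩
  simpa only [g, ContactSpectral.UniversalCover.shrink_one,
    ContactSpectral.UniversalCover.mk_mul_mk_shrink_zero] using h
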